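/- A set partition of $[n]=\{1,\dots,n\}$ is a collection of disjoint nonempty subsets (blocks) of $[n]$ with union $[n]$ (the empty set has exactly one set partition, with no blocks). For a set partition $\sigma$ of $[n]$ and $S\subseteq[n]$, the restriction of $\sigma$ to $S$ has as blocks the nonempty sets $B\cap S$ with $B$ a block of $\sigma$; its standardization is obtained by replacing the $i$-th smallest element of $S$ by $i$ for every $i$. Say that $\sigma$ contains a set partition $\tau$ of $[k]$ if for some $S\subseteq[n]$ the standardization of the restriction of $\sigma$ to $S$ equals $\tau$, and that $\sigma$ avoids $\tau$ otherwise. Let $\Pi_n(14/23)$ be the set of all set partitions of $[n]$ that avoid the set partition $14/23=\{\{1,4\},\{2,3\}\}$ of $[4]$, and let $\Pi_n^*(14/23)$ be the subset of those that have no block of size $1$. Put $$G(z)=\frac{z-2z^2(1+z)-z\sqrt{1-4z^2}}{-2+2z(1+z)^2},$$ where $\sqrt{1-4z^2}$ is the formal power series with constant term $1$ whose square is $1-4z^2$. **Theorem.** As formal power series, $$\sum_{n\ge 0}|\Pi_n(14/23)|\,z^n = G\!\left(\frac{z}{1-z}\right)\frac{1}{1-z}+\frac{1}{1-z},$$ and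 moreover $$G(z)=\sum_{n\ge 2}|\Pi_n^*(14/23)|\,z^n.$$ -/

import Mathlib

namespace KlazarPattern

open Finset

/-- The rank of `x` in `S`: the number of elements of `S` that are at most `x`. The smallest
element of `S` has rank `1`, the second smallest has rank `2`, and so on. -/
def rank (S : Finset ℕ) (x : ℕ) : ℕ := #{y ∈ S | y ≤ x}

theorem rank_lt_rank {S : Finset ℕ} {x y : ℕ} (hy : y ∈ S) (h : x < y) :
    rank S x < rank S y := by
  apply Finset.card_lt_card
  refine ⟨fun z hz => ?_, fun hsub => ?_⟩
  · simp only [mem_filter] at hz ⊢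
    exact ⟨hz.1, by omega⟩
  · have := hsub (mem_filter.2 ⟨hy, le_rfl⟩)
    simp only [mem_filter] at this
    omega

theorem rank_injOn (S : Finset ℕ) : Set.InjOn (rank S) S := by
  intro x hx y hy hxy
  rcases lt_trichotomy x y with h | h | h
  · exact absurd hxy (rank_lt_rank hy h).ne
  · exact h
  · exact absurd hxy (rank_lt_rank hx h).ne'

theorem image_rank (S : Finset ℕ) : S.image (rank S) = Icc 1 #S := by
  apply Finset.eq_of_subset_of_card_le
  · intro r hr
    obtain ⟨x, hx, rfl⟩ := mem_image.1 hr
    exact mem_Icc.2 ⟨Finset.card_pos.2 ⟨x, mem_filter.2 ⟨hx, le_rfl⟩⟩,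
      Finset.card_le_card (filter_subset _ _)⟩
  · rw [Finset.card_image_of_injOn (rank_injOn S)]
    simp

/-- The standardization of a set partition `σ` of a finite set `S` of integers: the set partition
of `{1, …, |S|}` obtained by replacing every element of `S` by its rank in `S`. -/
def standardize {S : Finset ℕ} (σ : Finpartition S) : Finpartition (Icc 1 #S) :=
  Finpartition.ofExistsUnique (σ.parts.image fun B => B.image (rank S))
    (by
      intro p hp
      obtain ⟨B, hB, rfl⟩ := mem_image.1 hp
      rw [← image_rank S]
      exact image_subset_image (σ.le hB))
    (by
      intro a ha
      rw [← image_rank S] at ha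
      obtain ⟨x, hx, rfl⟩ := mem_image.1 ha
      obtain ⟨B, ⟨hB, hxB⟩, huniq⟩ := σ.existsUnique_mem hx
      refine ⟨B.image (rank S), ⟨mem_image_of_mem _ hB, mem_image_of_mem _ hxB⟩, ?_⟩
      rintro t ⟨ht, hxt⟩
      obtain ⟨C, hC, rfl⟩ := mem_image.1 ht
      obtain ⟨y, hy, hyx⟩ := mem_image.1 hxt
      have hyx' : y = x := rank_injOn S (σ.le hC hy) hx hyx
      subst hyx'
      rw [huniq C ⟨hC, hy⟩])
    (by
      intro h
      obtain ⟨B, hB, hB'⟩ := mem_image.1 h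
      exact σ.ne_empty hB (image_eq_empty.1 hB'))

/-- `σ ⊢ [n]` contains `τ ⊢ [k]` as a pattern if there is `S ⊆ [n]` such that the standardization
of the restriction of `σ` to `S` is `τ`. The two partitions are compared through their sets of
blocks; equality of these already forces `|S| = k`, since the union of the blocks is `[|S|]` on
one side and `[k]` on the other. -/
def Contains {n k : ℕ} (σ : Finpartition (Icc 1 n)) (τ : Finpartition (Icc 1 k)) : Prop :=
  ∃ (S : Finset ℕ) (hS : S ⊆ Icc 1 n), (standardize (σ.restrict hS)).parts = τ.parts

open Classical in
/-- `Π_n(τ)`: the set partitions of `[n]` that avoid `τ`. -/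
noncomputable def avoiders (n : ℕ) {k : ℕ} (τ : Finpartition (Icc 1 k)) :
    Finset (Finpartition (Icc 1 n)) :=
  {σ | ¬ Contains σ τ}

/-- `Π_n^*(τ)`: the set partitions of `[n]` that avoid `τ` and have no singleton block. -/
noncomputable def singletonFreeAvoiders (n : ℕ) {k : ℕ} (τ : Finpartition (Icc 1 k)) :
    Finset (Finpartition (Icc 1 n)) :=
  {σ ∈ avoiders n τ | ∀ B ∈ σ.parts, #B ≠ 1}

/-- The set partition `14/23` of `[4]`. -/
def pattern14_23 : Finpartition (Icc 1 4) where
  parts := {{1, 4}, {2, 3}}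
  supIndep := by decide
  sup_parts := by decide
  bot_notMem := by decide

end KlazarPattern

namespace KlazarPattern

open PowerSeries

/-- The formal power series `√(1 - 4z²) = (1 + u)^(1/2)` with `u = -4z²`. -/
noncomputable def sqrtOneSubFourSq : PowerSeries ℚ :=
  (PowerSeries.binomialSeries ℚ (1 / 2 : ℚ)).subst (-4 * X ^ 2 : PowerSeries ℚ)

theorem hasSubst_neg_four_sq : HasSubst (-4 * X ^ 2 : PowerSeries ℚ) :=
  HasSubst.of_constantCoeff_zero' (by simp)

/-- `sqrtOneSubFourSq` is a square root of `1 - 4z²`; with the next fact this determines it. -/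
theorem sqrtOneSubFourSq_sq : sqrtOneSubFourSq ^ 2 = 1 - 4 * X ^ 2 := by
  have h : PowerSeries.binomialSeries ℚ (1 / 2 : ℚ) ^ 2 = 1 + X := by
    rw [sq, ← binomialSeries_add, show (1 / 2 + 1 / 2 : ℚ) = ((1 : ℕ) : ℚ) by norm_num,
      binomialSeries_nat, pow_one]
  rw [sqrtOneSubFourSq, ← subst_pow hasSubst_neg_four_sq, h, subst_add hasSubst_neg_four_sq,
    subst_X hasSubst_neg_four_sq, ← coe_substAlgHom hasSubst_neg_four_sq, map_one]
  ring

theorem constantCoeff_sqrtOneSubFourSq : constantCoeff sqrtOneSubFourSq = 1 := by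
  have h : constantCoeff (PowerSeries.binomialSeries ℚ (1 / 2 : ℚ) - 1) = 0 := by simp
  have h2 : sqrtOneSubFourSq =
      (PowerSeries.binomialSeries ℚ (1 / 2 : ℚ) - 1).subst (-4 * X ^ 2 : PowerSeries ℚ) + 1 := by
    rw [sqrtOneSubFourSq, subst_sub hasSubst_neg_four_sq,
      ← coe_substAlgHom hasSubst_neg_four_sq, map_one, sub_add_cancel]
  have h3 : constantCoeff ((PowerSeries.binomialSeries ℚ (1 / 2 : ℚ) - 1).subst
      (-4 * X ^ 2 : PowerSeries ℚ)) = 0 :=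
    constantCoeff_subst_eq_zero (a := (-4 * X ^ 2 : PowerSeries ℚ))
      (show constantCoeff (-4 * X ^ 2 : PowerSeries ℚ) = 0 by simp) _ h
  rw [h2, map_add, h3, map_one, zero_add]

/-- `G(z) = (z - 2z²(1 + z) - z√(1 - 4z²)) / (-2 + 2z(1 + z)²)` as a formal power series; the
denominator has constant term `-2`, so it is invertible. -/
noncomputable def G : PowerSeries ℚ :=
  (X - 2 * X ^ 2 * (1 + X) - X * sqrtOneSubFourSq) * (-2 + 2 * X * (1 + X) ^ 2)⁻¹

/-- The formal power series `z / (1 - z)`. -/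
noncomputable def zDivOneSub : PowerSeries ℚ := X * (1 - X)⁻¹

theorem hasSubst_zDivOneSub : HasSubst zDivOneSub :=
  HasSubst.of_constantCoeff_zero' (by simp [zDivOneSub])

end KlazarPattern

/-! A partition avoids 14/23 exactly when no two elements of one block lie strictly between two
elements of another. Mark each element as opener, closer, transient (inner element of its block) or
singleton, and let the height be openers minus closers so far. Avoidance forces blocks with at least
two elements to close in the order in which they open (`up_letters`). It also forces a transient to
sit at height 1: a second block open there would enclose, or be enclosed by, a pair from the
transient's block. Conversely, joining the k-th opener to the k-th closer, and each transient to the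
only open block, recovers the partition. Thus `letters` is a bijection onto lattice paths from
height 0 to 0 with level steps at height 1 (transients) and, if allowed, singleton level steps at
every height (`isPath_letters`, `mem_part_iff_linked`, `IsPath.letters_ofWord`,
`IsPath.not_hasNesting`).

Splitting off the last step gives a linear system for the generating functions by final height, with
a unique solution (`IsPathSystem.unique`). Without singletons it is solved explicitly in terms of
the square root. Allowing singletons amounts to substituting z/(1-z) and multiplying by 1/(1-z). -/

namespace KlazarPattern

open Finset

/-! ### Containing 14/23 as the existence of a nesting. -/

section Containment

theorem rank_le_rank (S : Finset ℕ) {x y : ℕ} (h : x ≤ y) : rank S x ≤ rank S y :=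
  card_le_card fun _ hz => mem_filter.2 ⟨(mem_filter.1 hz).1, (mem_filter.1 hz).2.trans h⟩

theorem lt_of_rank_lt_rank {S : Finset ℕ} {x y : ℕ} (h : rank S x < rank S y) : x < y :=
  lt_of_not_ge fun hyx => absurd (rank_le_rank S hyx) (not_le.2 h)

/-- `a < b < c < d` witness a nesting of `σ`: `a, d` lie in one block, `b, c` in another. -/
def HasNesting {n : ℕ} (σ : Finpartition (Icc 1 n)) : Prop :=
  ∃ a b c d, a < b ∧ b < c ∧ c < d ∧ d ∈ σ.part a ∧ c ∈ σ.part b ∧ b ∉ σ.part a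

theorem mem_parts_standardize_restrict {n : ℕ} {σ : Finpartition (Icc 1 n)} {S : Finset ℕ}
    {hS : S ⊆ Icc 1 n} {p : Finset ℕ} :
    p ∈ (standardize (σ.restrict hS)).parts ↔
      ∃ B ∈ σ.parts, (B ∩ S).Nonempty ∧ (B ∩ S).image (rank S) = p := by
  simp only [standardize, Finpartition.ofExistsUnique, Finpartition.restrict, mem_image,
    mem_erase]
  constructor
  · rintro ⟨_, ⟨hne, B, hB, rfl⟩, rfl⟩
    exact ⟨B, hB, nonempty_iff_ne_empty.2 hne, rfl⟩
  · rintro ⟨B, hB, hne, rfl⟩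
    exact ⟨_, ⟨nonempty_iff_ne_empty.1 hne, B, hB, rfl⟩, rfl⟩

theorem HasNesting.of_contains {n : ℕ} {σ : Finpartition (Icc 1 n)}
    (h : Contains σ pattern14_23) : HasNesting σ := by
  obtain ⟨S, hS, h⟩ := h
  have h1 : ({1, 4} : Finset ℕ) ∈ (standardize (σ.restrict hS)).parts := by
    rw [h]; simp [pattern14_23]
  have h2 : ({2, 3} : Finset ℕ) ∈ (standardize (σ.restrict hS)).parts := by
    rw [h]; simp [pattern14_23]
  obtain ⟨A, hA, -, hA'⟩ := mem_parts_standardize_restrict.1 h1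
  obtain ⟨B, hB, -, hB'⟩ := mem_parts_standardize_restrict.1 h2
  obtain ⟨a, ha, ra⟩ := mem_image.1 (hA' ▸ (by simp : 1 ∈ ({1, 4} : Finset ℕ)))
  obtain ⟨d, hd, rd⟩ := mem_image.1 (hA' ▸ (by simp : 4 ∈ ({1, 4} : Finset ℕ)))
  obtain ⟨b, hb, rb⟩ := mem_image.1 (hB' ▸ (by simp : 2 ∈ ({2, 3} : Finset ℕ)))
  obtain ⟨c, hc, rc⟩ := mem_image.1 (hB' ▸ (by simp : 3 ∈ ({2, 3} : Finset ℕ)))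
  rw [mem_inter] at ha hb hc hd
  have pa := σ.part_eq_of_mem hA ha.1
  have pb := σ.part_eq_of_mem hB hb.1
  refine ⟨a, b, c, d, lt_of_rank_lt_rank (S := S) (by omega),
    lt_of_rank_lt_rank (S := S) (by omega), lt_of_rank_lt_rank (S := S) (by omega),
    pa ▸ hd.1, pb ▸ hc.1, fun hba => ?_⟩
  rw [pa] at hba
  have hAB := σ.eq_of_mem_parts hA hB hba hb.1
  rw [← hAB, hA'] at hB'
  exact absurd hB' (by decide)

theorem HasNesting.contains {n : ℕ} {σ : Finpartition (Icc 1 n)} (h : HasNesting σ) :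
    Contains σ pattern14_23 := by
  obtain ⟨a, b, c, d, hab, hbc, hcd, had, hbc', hba⟩ := h
  have pa : σ.part a ∈ σ.parts := by
    obtain ⟨p, hp, -, ha⟩ := (σ.mem_part_iff_exists).1 had
    rwa [σ.part_eq_of_mem hp ha]
  have pb : σ.part b ∈ σ.parts := by
    obtain ⟨p, hp, -, hb⟩ := (σ.mem_part_iff_exists).1 hbc'
    rwa [σ.part_eq_of_mem hp hb]
  have ha : a ∈ σ.part a := σ.mem_part_self.2 (σ.part_mem.1 pa)
  have hb : b ∈ σ.part b := σ.mem_part_self.2 (σ.part_mem.1 pb)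
  have key : ∀ B ∈ σ.parts, ∀ x, x ∈ σ.part a → x ∈ B → B = σ.part a :=
    fun B hB x hx hxB => σ.eq_of_mem_parts hB pa hxB hx
  have key' : ∀ B ∈ σ.parts, ∀ x, x ∈ σ.part b → x ∈ B → B = σ.part b :=
    fun B hB x hx hxB => σ.eq_of_mem_parts hB pb hxB hx
  have hne : σ.part a ≠ σ.part b := fun h => hba (h ▸ hb)
  have hca : c ∉ σ.part a := fun h => hne (key' _ pa c hbc' h)
  have hab' : a ∉ σ.part b := fun h => hne (key _ pb a ha h).symm
  have hdb : d ∉ σ.part b := fun h => hne (key _ pb d had h).symm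
  have hS : ({a, b, c, d} : Finset ℕ) ⊆ Icc 1 n := by
    intro x hx
    simp only [mem_insert, mem_singleton] at hx
    rcases hx with rfl | rfl | rfl | rfl
    · exact σ.le pa ha
    · exact σ.le pb hb
    · exact σ.le pb hbc'
    · exact σ.le pa had
  have hAS : σ.part a ∩ {a, b, c, d} = {a, d} := by
    ext x
    simp only [mem_inter, mem_insert, mem_singleton]
    constructor
    · rintro ⟨hx, rfl | rfl | rfl | rfl⟩
      exacts [Or.inl rfl, absurd hx hba, absurd hx hca, Or.inr rfl]
    · rintro (rfl | rfl)
      exacts [⟨ha, by simp⟩, ⟨had, by simp⟩]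
  have hBS : σ.part b ∩ {a, b, c, d} = {b, c} := by
    ext x
    simp only [mem_inter, mem_insert, mem_singleton]
    constructor
    · rintro ⟨hx, rfl | rfl | rfl | rfl⟩
      exacts [absurd hx hab', Or.inl rfl, Or.inr rfl, absurd hx hdb]
    · rintro (rfl | rfl)
      exacts [⟨hb, by simp⟩, ⟨hbc', by simp⟩]
  have rk : ∀ x, rank {a, b, c, d} x = #{y ∈ ({a, b, c, d} : Finset ℕ) | y ≤ x} := fun _ => rfl
  have ra : rank {a, b, c, d} a = 1 := by
    rw [rk, show ({y ∈ ({a, b, c, d} : Finset ℕ) | y ≤ a}) = {a} by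
      ext; simp only [mem_filter, mem_insert, mem_singleton]; omega]
    rfl
  have rb : rank {a, b, c, d} b = 2 := by
    rw [rk, show ({y ∈ ({a, b, c, d} : Finset ℕ) | y ≤ b}) = {a, b} by
      ext; simp only [mem_filter, mem_insert, mem_singleton]; omega]
    exact card_pair (by omega)
  have rc : rank {a, b, c, d} c = 3 := by
    rw [rk, show ({y ∈ ({a, b, c, d} : Finset ℕ) | y ≤ c}) = {a, b, c} by
      ext; simp only [mem_filter, mem_insert, mem_singleton]; omega]
    exact card_eq_three.2 ⟨a, b, c, by omega, by omega, by omega, rfl⟩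
  have rd : rank {a, b, c, d} d = 4 := by
    rw [rk, show ({y ∈ ({a, b, c, d} : Finset ℕ) | y ≤ d}) = insert a {b, c, d} by
      ext; simp only [mem_filter, mem_insert, mem_singleton]; omega,
      card_insert_of_notMem (by simp; omega)]
    rw [card_eq_three.2 ⟨b, c, d, by omega, by omega, by omega, rfl⟩]
  have iA : (σ.part a ∩ {a, b, c, d}).image (rank {a, b, c, d}) = {1, 4} := by
    rw [hAS, image_insert, image_singleton, ra, rd]
  have iB : (σ.part b ∩ {a, b, c, d}).image (rank {a, b, c, d}) = {2, 3} := by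
    rw [hBS, image_insert, image_singleton, rb, rc]
  refine ⟨{a, b, c, d}, hS, ?_⟩
  ext p
  rw [mem_parts_standardize_restrict]
  simp only [pattern14_23, mem_insert, mem_singleton]
  constructor
  · rintro ⟨B, hB, ⟨x, hx⟩, rfl⟩
    simp only [mem_inter, mem_insert, mem_singleton] at hx
    have : B = σ.part a ∨ B = σ.part b := by
      rcases hx with ⟨hx, rfl | rfl | rfl | rfl⟩
      · exact Or.inl (key B hB _ ha hx)
      · exact Or.inr (key' B hB _ hb hx)
      · exact Or.inr (key' B hB _ hbc' hx)
      · exact Or.inl (key B hB _ had hx)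
    rcases this with rfl | rfl
    · exact Or.inl iA
    · exact Or.inr iB
  · rintro (rfl | rfl)
    · exact ⟨_, pa, by rw [hAS]; simp, iA⟩
    · exact ⟨_, pb, by rw [hBS]; simp, iB⟩

theorem mem_avoiders {n : ℕ} {σ : Finpartition (Icc 1 n)} :
    σ ∈ avoiders n pattern14_23 ↔ ¬ HasNesting σ := by
  simp only [avoiders, mem_filter, mem_univ, true_and]
  exact not_congr ⟨HasNesting.of_contains, HasNesting.contains⟩

end Containment

end KlazarPattern

namespace KlazarPattern

open PowerSeries

/-! ### Solving the functional equations for the path generating functions. -/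

section Series

/-- The functional equations satisfied by the generating functions `B h` of paths ending at height
`h`, where a level step has weight `a`, increased by `1` at height `1`. -/
structure IsPathSystem (a : ℚ) (B : ℕ → PowerSeries ℚ) : Prop where
  zero : B 0 = 1 + X * (B 1 + C a * B 0)
  one : B 1 = X * (B 0 + B 2 + (1 + C a) * B 1)
  add_two : ∀ h, B (h + 2) = X * (B (h + 1) + B (h + 3) + C a * B (h + 2))

/-- Every unknown on the right-hand sides carries a factor X, so the coefficients of degree n at all
heights determine those of degree n + 1. -/
theorem IsPathSystem.unique {a : ℚ} {B B' : ℕ → PowerSeries ℚ} (hB : IsPathSystem a B)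
    (hB' : IsPathSystem a B') (h : ℕ) : B h = B' h := by
  ext n
  induction n generalizing h with
  | zero =>
    rcases h with _ | _ | h
    · rw [hB.zero, hB'.zero]; simp
    · rw [hB.one, hB'.one]; simp
    · rw [hB.add_two, hB'.add_two]; simp
  | succ n ih =>
    rcases h with _ | _ | h
    · rw [hB.zero, hB'.zero]
      simp [coeff_succ_X_mul, ih]
    · rw [zero_add, hB.one, hB'.one]
      simp [coeff_succ_X_mul, ih, add_mul]
    · rw [hB.add_two, hB'.add_two]
      simp [coeff_succ_X_mul, ih]

/-- The series l = (1 - √(1 - 4X²)) / (2X) is X times the Catalan series in X². Its quadratic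
equation replaces the square root in later computations. -/
theorem exists_sqrt_eq : ∃ l : PowerSeries ℚ, sqrtOneSubFourSq = 1 - 2 * X * l ∧
    l = X + X * l ^ 2 := by
  have h : (X : PowerSeries ℚ) ∣ 1 - sqrtOneSubFourSq := by
    rw [X_dvd_iff]; simp [constantCoeff_sqrtOneSubFourSq]
  obtain ⟨l, hl⟩ := h
  have h2 : (C (1 / 2 : ℚ)) * 2 = (1 : PowerSeries ℚ) := by
    rw [← map_ofNat (C (R := ℚ)) 2, ← map_mul]; norm_num
  have e : sqrtOneSubFourSq = 1 - 2 * X * (C (1 / 2 : ℚ) * l) := by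
    linear_combination (-1 : PowerSeries ℚ) * hl + X * l * h2
  refine ⟨C (1 / 2 : ℚ) * l, e, ?_⟩
  have hs := sqrtOneSubFourSq_sq
  rw [e] at hs
  generalize C (1 / 2 : ℚ) * l = m at *
  have : (4 * X : PowerSeries ℚ) ≠ 0 := by
    rw [← map_ofNat (C (R := ℚ)) 4]
    exact mul_ne_zero (by rw [Ne, _root_.map_eq_zero]; exact four_ne_zero) X_ne_zero
  apply mul_left_cancel₀ this
  linear_combination (-1 : PowerSeries ℚ) * hs

theorem exists_isPathSystem_zero :
    ∃ B : ℕ → PowerSeries ℚ, IsPathSystem 0 B ∧ B 0 = 1 + G := by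
  obtain ⟨l, hs, hl⟩ := exists_sqrt_eq
  have hD : (1 - X - X ^ 2 - X * l) * (1 - X - X ^ 2 - X * l)⁻¹ = 1 :=
    PowerSeries.mul_inv_cancel _ (by simp)
  set E := (1 - X - X ^ 2 - X * l)⁻¹ with hE
  have hE' : (-2 + 2 * X * (1 + X) ^ 2) * (-2 + 2 * X * (1 + X) ^ 2 : PowerSeries ℚ)⁻¹ = 1 :=
    PowerSeries.mul_inv_cancel _ (by rw [← map_ofNat (C (R := ℚ)) 2]; simp)
  -- From height 1 upward the recurrence is homogeneous, so the solution is geometric with ratio l.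
  -- The equations at heights 0 and 1 fix the factor E.
  refine ⟨fun h => h.casesOn (1 + X * (X * E)) fun h => X * E * l ^ h, ⟨?_, ?_, ?_⟩, ?_⟩
  · simp
  · simp only [map_zero]
    show X * E * l ^ 0 = X * (1 + X * (X * E) + X * E * l ^ 1 + (1 + 0) * (X * E * l ^ 0))
    linear_combination X * hD
  · intro h
    simp only [map_zero]
    linear_combination (X * E * l ^ h) * hl
  · have hne : (-2 + 2 * X * (1 + X) ^ 2 : PowerSeries ℚ) ≠ 0 := by
      intro h; rw [h] at hE'; simp at hE'
    have hne2 : (1 - X - X ^ 2 - X * l : PowerSeries ℚ) ≠ 0 := by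
      intro h; rw [h] at hD; simp at hD
    show 1 + X * (X * E) = 1 + G
    rw [G, hs]
    generalize (-2 + 2 * X * (1 + X) ^ 2 : PowerSeries ℚ)⁻¹ = K at *
    -- Clearing both denominators turns G = X²E into a polynomial identity modulo l = X + Xl².
    apply mul_left_cancel₀ hne
    apply mul_left_cancel₀ hne2
    linear_combination (-2 + 2 * X * (1 + X) ^ 2) * X ^ 2 * hD -
      (1 - X - X ^ 2 - X * l) * (-2 * X ^ 2 * (1 + X) + 2 * X ^ 2 * l) * hE' - 2 * X ^ 2 * hl

/-- Any number of extra level steps may follow each step, turning z into z/(1-z), and precede the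
whole path, giving the factor 1/(1-z). Algebraically only (1 - X) · `zDivOneSub` = X is needed. -/
theorem IsPathSystem.substZDivOneSub {B : ℕ → PowerSeries ℚ} (hB : IsPathSystem 0 B) :
    IsPathSystem 1 fun h => (B h).subst zDivOneSub * (1 - X)⁻¹ := by
  have hinv : (1 - X) * (1 - X : PowerSeries ℚ)⁻¹ = 1 := PowerSeries.mul_inv_cancel _ (by simp)
  have hz : (1 - X) * zDivOneSub = X := by
    rw [zDivOneSub]; linear_combination X * hinv
  have hX : (X : PowerSeries ℚ).subst zDivOneSub = zDivOneSub := subst_X hasSubst_zDivOneSub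
  have h0 := congrArg (substAlgHom (R := ℚ) hasSubst_zDivOneSub) hB.zero
  have h1 := congrArg (substAlgHom (R := ℚ) hasSubst_zDivOneSub) hB.one
  have h2 := fun h => congrArg (substAlgHom (R := ℚ) hasSubst_zDivOneSub) (hB.add_two h)
  simp only [map_zero, zero_mul, add_zero, map_add, map_mul, map_one, coe_substAlgHom, hX]
    at h0 h1 h2
  refine ⟨?_, ?_, fun h => ?_⟩
  · simp only [map_one]
    linear_combination (1 - X) * (1 - X)⁻¹ * h0 + hinv +
      (1 - X)⁻¹ * PowerSeries.subst zDivOneSub (B 1) * hz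
  · simp only [map_one]
    linear_combination (1 - X) * (1 - X)⁻¹ * h1 +
      (1 - X)⁻¹ * (PowerSeries.subst zDivOneSub (B 0) + PowerSeries.subst zDivOneSub (B 2) +
        PowerSeries.subst zDivOneSub (B 1)) * hz
  · simp only [map_one]
    linear_combination (1 - X) * (1 - X)⁻¹ * h2 h +
      (1 - X)⁻¹ * (PowerSeries.subst zDivOneSub (B (h + 1)) +
        PowerSeries.subst zDivOneSub (B (h + 3))) * hz

theorem isPathSystem_closed_form {a : ℚ} (ha : a = 0 ∨ a = 1) {B : ℕ → PowerSeries ℚ}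
    (hB : IsPathSystem a B) : B 0 = if a = 0 then 1 + G else
      G.subst zDivOneSub * (1 - X)⁻¹ + (1 - X)⁻¹ := by
  obtain ⟨A, hA, hA0⟩ := exists_isPathSystem_zero
  rcases ha with rfl | rfl
  · rw [if_pos rfl, ← hA0]
    exact hB.unique hA 0
  · rw [if_neg one_ne_zero, hB.unique hA.substZDivOneSub 0, hA0, subst_add hasSubst_zDivOneSub,
      ← coe_substAlgHom hasSubst_zDivOneSub, map_one]
    ring

end Series

end KlazarPattern

namespace KlazarPattern

open Finset

/-! ### Lattice paths and their recursion by the last step. -/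

section Paths

/-- The number of openers, that is of letters `(false, true)`, among the first `x` letters. -/
def up (t : ℕ → Bool × Bool) (x : ℕ) : ℕ := #{y ∈ Icc 1 x | t y = (false, true)}

/-- The number of closers, that is of letters `(true, false)`, among the first `x` letters. -/
def dn (t : ℕ → Bool × Bool) (x : ℕ) : ℕ := #{y ∈ Icc 1 x | t y = (true, false)}

theorem up_zero (t : ℕ → Bool × Bool) : up t 0 = 0 := rfl

theorem dn_zero (t : ℕ → Bool × Bool) : dn t 0 = 0 := rfl

theorem up_succ (t : ℕ → Bool × Bool) (x : ℕ) :
    up t (x + 1) = up t x + if t (x + 1) = (false, true) then 1 else 0 := by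
  rw [up, up, ← insert_Icc_right_eq_Icc_add_one (by omega), filter_insert]
  split_ifs
  · rw [card_insert_of_notMem (by simp)]
  · rfl

theorem dn_succ (t : ℕ → Bool × Bool) (x : ℕ) :
    dn t (x + 1) = dn t x + if t (x + 1) = (true, false) then 1 else 0 := by
  rw [dn, dn, ← insert_Icc_right_eq_Icc_add_one (by omega), filter_insert]
  split_ifs
  · rw [card_insert_of_notMem (by simp)]
  · rfl

theorem up_congr {t t' : ℕ → Bool × Bool} {x : ℕ} (h : ∀ y ∈ Icc 1 x, t y = t' y) :
    up t x = up t' x := by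
  rw [up, up, filter_congr fun y hy => by rw [h y hy]]

theorem dn_congr {t t' : ℕ → Bool × Bool} {x : ℕ} (h : ∀ y ∈ Icc 1 x, t y = t' y) :
    dn t x = dn t' x := by
  rw [dn, dn, filter_congr fun y hy => by rw [h y hy]]

/-- The word `t` on `[n]` is a lattice path from height `0` to height `h` that stays nonnegative.
Openers go up and closers go down; a letter `(true, true)` is a level step at height `1`, a letter
`(false, false)` a level step at any height, allowed only if `a` is true. -/
structure IsPath (a : Bool) (n h : ℕ) (t : ℕ → Bool × Bool) : Prop where
  supp : ∀ x ∉ Icc 1 n, t x = (false, false)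
  dn_le_up : ∀ x ≤ n, dn t x ≤ up t x
  transient : ∀ x ∈ Icc 1 n, t x = (true, true) → up t x = dn t x + 1
  isolated : ∀ x ∈ Icc 1 n, t x = (false, false) → a = true
  height : up t n = dn t n + h

/-- The letter `v` may lead a path from height `h` to height `k`. -/
def IsStep (a : Bool) (h k : ℕ) : Bool × Bool → Prop
  | (false, true) => k = h + 1
  | (true, false) => h = k + 1
  | (true, true) => h = 1 ∧ k = 1
  | (false, false) => a = true ∧ k = h

theorem isPath_zero {a : Bool} {h : ℕ} {t : ℕ → Bool × Bool} :
    IsPath a 0 h t ↔ h = 0 ∧ t = fun _ => (false, false) := by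
  constructor
  · intro H
    exact ⟨by simpa [up_zero, dn_zero, eq_comm] using H.height,
      funext fun x => H.supp x (by simp)⟩
  · rintro ⟨rfl, rfl⟩
    exact ⟨fun _ _ => rfl, by simp [up, dn], by simp, by simp, rfl⟩

/-- Deleting the last letter means resetting it to `(false, false)`, the value words take outside
their support. -/
theorem isPath_succ {a : Bool} {n k : ℕ} {t : ℕ → Bool × Bool} :
    IsPath a (n + 1) k t ↔
      ∃ h, IsPath a n h (Function.update t (n + 1) (false, false)) ∧ IsStep a h k (t (n + 1)) := by
  have hup : ∀ x ≤ n, up (Function.update t (n + 1) (false, false)) x = up t x := fun x hx =>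
    up_congr fun y hy => Function.update_of_ne (by rw [mem_Icc] at hy; omega) _ _
  have hdn : ∀ x ≤ n, dn (Function.update t (n + 1) (false, false)) x = dn t x := fun x hx =>
    dn_congr fun y hy => Function.update_of_ne (by rw [mem_Icc] at hy; omega) _ _
  have hu := up_succ t n
  have hd := dn_succ t n
  constructor
  · intro H
    have h1 := H.dn_le_up n (by omega)
    have h2 := H.dn_le_up (n + 1) le_rfl
    have h3 := H.transient (n + 1) (by simp)
    have h4 := H.isolated (n + 1) (by simp)
    have h5 := H.height
    -- The natural subtraction is exact by `h1`.
    refine ⟨up t n - dn t n, ⟨fun x hx => ?_, fun x hx => ?_, fun x hx hxt => ?_,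
      fun x hx hxt => ?_, ?_⟩, ?_⟩
    · by_cases hxn : x = n + 1
      · rw [hxn, Function.update_self]
      · rw [Function.update_of_ne hxn]
        exact H.supp x (by rw [mem_Icc] at hx ⊢; omega)
    · rw [hup x hx, hdn x hx]
      exact H.dn_le_up x (by omega)
    · rw [mem_Icc] at hx
      rw [Function.update_of_ne (by omega)] at hxt
      rw [hup x hx.2, hdn x hx.2]
      exact H.transient x (mem_Icc.2 (by omega)) hxt
    · rw [mem_Icc] at hx
      rw [Function.update_of_ne (by omega)] at hxt
      exact H.isolated x (mem_Icc.2 (by omega)) hxt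
    · rw [hup n le_rfl, hdn n le_rfl]; omega
    · rcases ht : t (n + 1) with ⟨_ | _, _ | _⟩ <;> simp [ht] at hu hd h3 h4 <;>
        simp only [IsStep] <;> first | omega | exact ⟨h4, by omega⟩
  · rintro ⟨h, H, hs⟩
    have h1 := H.height
    rw [hup n le_rfl, hdn n le_rfl] at h1
    refine ⟨fun x hx => ?_, fun x hx => ?_, fun x hx hxt => ?_, fun x hx hxt => ?_, ?_⟩
    · rw [mem_Icc] at hx
      rw [← H.supp x (by rw [mem_Icc]; omega), Function.update_of_ne (by omega)]
    · rcases Nat.lt_or_ge n x with hxn | hxn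
      · obtain rfl : x = n + 1 := by omega
        rcases ht : t (n + 1) with ⟨_ | _, _ | _⟩ <;> simp [ht, IsStep] at hu hd hs <;> omega
      · rw [← hup x hxn, ← hdn x hxn]
        exact H.dn_le_up x hxn
    · rw [mem_Icc] at hx
      rcases Nat.lt_or_ge n x with hxn | hxn
      · obtain rfl : x = n + 1 := by omega
        simp [hxt, IsStep] at hu hd hs
        omega
      · rw [← hup x hxn, ← hdn x hxn]
        exact H.transient x (mem_Icc.2 ⟨hx.1, hxn⟩)
          (by rw [Function.update_of_ne (by omega), hxt])
    · rw [mem_Icc] at hx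
      rcases Nat.lt_or_ge n x with hxn | hxn
      · obtain rfl : x = n + 1 := by omega
        rw [hxt] at hs
        exact hs.1
      · exact H.isolated x (mem_Icc.2 ⟨hx.1, hxn⟩) (by rw [Function.update_of_ne (by omega), hxt])
    · rcases ht : t (n + 1) with ⟨_ | _, _ | _⟩ <;> simp [ht, IsStep] at hu hd hs <;> omega

open Classical in
/-- The words obtained from those in `P` by setting the letter at position `n` to `v`. -/
noncomputable def setLetter (n : ℕ) (v : Bool × Bool) (P : Finset (ℕ → Bool × Bool)) :
    Finset (ℕ → Bool × Bool) :=
  P.image fun t => Function.update t n v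

section setLetter

variable {n : ℕ} {v : Bool × Bool} {P : Finset (ℕ → Bool × Bool)}

open Classical in
theorem mem_setLetter (hP : ∀ t ∈ P, t n = (false, false)) {t : ℕ → Bool × Bool} :
    t ∈ setLetter n v P ↔ Function.update t n (false, false) ∈ P ∧ t n = v := by
  rw [setLetter, mem_image]
  constructor
  · rintro ⟨s, hs, rfl⟩
    rw [Function.update_idem, ← hP s hs, Function.update_eq_self, Function.update_self]
    exact ⟨hs, rfl⟩
  · rintro ⟨h, rfl⟩
    exact ⟨_, h, by rw [Function.update_idem, Function.update_eq_self]⟩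

open Classical in
theorem card_setLetter (hP : ∀ t ∈ P, t n = (false, false)) : #(setLetter n v P) = #P := by
  refine card_image_of_injOn fun s hs t ht hst => ?_
  have := congrArg (fun r => Function.update r n (false, false)) hst
  simp only [Function.update_idem] at this
  rwa [← hP s hs, Function.update_eq_self, hP s hs, ← hP t ht, Function.update_eq_self] at this

end setLetter

open Classical in
/-- The finite set of all paths described by `IsPath`. -/
noncomputable def paths (a : Bool) : ℕ → ℕ → Finset (ℕ → Bool × Bool)
  | 0, h => if h = 0 then {fun _ => (false, false)} else ∅
  | n + 1, h =>
    setLetter (n + 1) (false, true) (if h = 0 then ∅ else paths a n (h - 1)) ∪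
    (setLetter (n + 1) (true, false) (paths a n (h + 1)) ∪
    (setLetter (n + 1) (true, true) (if h = 1 then paths a n 1 else ∅) ∪
      setLetter (n + 1) (false, false) (if a = true then paths a n h else ∅)))

open Classical in
theorem mem_paths {a : Bool} {n h : ℕ} {t : ℕ → Bool × Bool} :
    t ∈ paths a n h ↔ IsPath a n h t := by
  induction n generalizing h t with
  | zero =>
    rw [isPath_zero, paths]
    split_ifs with h0 <;> simp [h0]
  | succ n ih =>
    have hP : ∀ h, ∀ t ∈ paths a n h, t (n + 1) = (false, false) := fun h t ht =>
      (ih.1 ht).supp _ (by simp)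
    have hP' : ∀ (p : Prop) [Decidable p], ∀ h, ∀ t ∈ (if p then paths a n h else ∅),
        t (n + 1) = (false, false) := fun p _ h t ht => by
      split_ifs at ht
      · exact hP h t ht
      · simp at ht
    have hP'' : ∀ t ∈ (if h = 0 then ∅ else paths a n (h - 1)),
        t (n + 1) = (false, false) := fun t ht => by
      split_ifs at ht
      · simp at ht
      · exact hP _ t ht
    rw [isPath_succ, paths, mem_union, mem_union, mem_union, mem_setLetter hP'',
      mem_setLetter (hP _), mem_setLetter (hP' _ _), mem_setLetter (hP' _ _)]
    rcases t (n + 1) with ⟨_ | _, _ | _⟩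
    · simp only [IsStep, ← ih]
      split_ifs <;> simp_all
    · rcases h with _ | h <;> simp [IsStep, ← ih]
    · simp [IsStep, ← ih]
    · simp only [IsStep, ← ih]
      split_ifs <;> simp_all

open Classical in
-- The four unions are disjoint because their words differ at position n + 1.
theorem card_paths_succ (a : Bool) (n h : ℕ) : #(paths a (n + 1) h) =
    (if h = 0 then 0 else #(paths a n (h - 1))) + (#(paths a n (h + 1)) +
      ((if h = 1 then #(paths a n 1) else 0) + if a = true then #(paths a n h) else 0)) := by
  have hP : ∀ h, ∀ t ∈ paths a n h, t (n + 1) = (false, false) := fun h t ht =>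
    (mem_paths.1 ht).supp _ (by simp)
  have hP' : ∀ (p : Prop) [Decidable p], ∀ h, ∀ t ∈ (if p then paths a n h else ∅),
      t (n + 1) = (false, false) := fun p _ h t ht => by
    split_ifs at ht
    · exact hP h t ht
    · simp at ht
  have hP'' : ∀ t ∈ (if h = 0 then ∅ else paths a n (h - 1)),
      t (n + 1) = (false, false) := fun t ht => by
    split_ifs at ht
    · simp at ht
    · exact hP _ t ht
  rw [paths, card_union_of_disjoint, card_union_of_disjoint, card_union_of_disjoint,
    card_setLetter hP'', card_setLetter (hP _), card_setLetter (hP' _ _),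
    card_setLetter (hP' _ _)]
  · simp only [apply_ite card, card_empty]
  all_goals
    rw [disjoint_left]
    intro t h1 h2
    simp only [mem_union, mem_setLetter hP'', mem_setLetter (hP _), mem_setLetter (hP' _ _)]
      at h1 h2
    simp [h1.2] at h2

open PowerSeries in
theorem isPathSystem_paths (a : Bool) : IsPathSystem (if a = true then 1 else 0)
    fun h => mk fun n => (#(paths a n h) : ℚ) := by
  cases a
  all_goals
    refine ⟨?_, ?_, fun h => ?_⟩ <;> ext n <;> rcases n with _ | n
    · simp [paths]
    · simp [coeff_succ_X_mul, card_paths_succ, coeff_one]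
    · simp [paths]
    · simp only [Bool.false_eq_true, if_true, if_false, map_zero, map_one, add_mul, one_mul,
        zero_mul, map_add, coeff_succ_X_mul, coeff_mk, card_paths_succ]
      push_cast
      try simp
      try ring
    · simp [paths]
    · simp [coeff_succ_X_mul, card_paths_succ]
      try ring

end Paths

end KlazarPattern

namespace KlazarPattern

open Finset

/-! ### Counting openers and closers. -/

section Counting

variable {t : ℕ → Bool × Bool}

theorem up_mono (t : ℕ → Bool × Bool) : Monotone (up t) := fun _ _ h =>
  card_le_card (filter_subset_filter _ (Icc_subset_Icc_right h))

theorem dn_mono (t : ℕ → Bool × Bool) : Monotone (dn t) := fun _ _ h =>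
  card_le_card (filter_subset_filter _ (Icc_subset_Icc_right h))

theorem up_lt_up {x y : ℕ} (h : x < y) (ht : t y = (false, true)) : up t x < up t y := by
  obtain ⟨z, rfl⟩ : ∃ z, y = z + 1 := ⟨y - 1, by omega⟩
  have := up_mono t (Nat.lt_succ_iff.1 h)
  rw [up_succ, if_pos ht]
  omega

theorem dn_lt_dn {x y : ℕ} (h : x < y) (ht : t y = (true, false)) : dn t x < dn t y := by
  obtain ⟨z, rfl⟩ : ∃ z, y = z + 1 := ⟨y - 1, by omega⟩
  have := dn_mono t (Nat.lt_succ_iff.1 h)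
  rw [dn_succ, if_pos ht]
  omega

theorem exists_opener {k x : ℕ} (hk : 1 ≤ k) (hkx : k ≤ up t x) :
    ∃ y ∈ Icc 1 x, t y = (false, true) ∧ up t y = k := by
  induction x with
  | zero => rw [up_zero] at hkx; omega
  | succ x ih =>
    rcases Nat.lt_or_ge (up t x) k with h | h
    · have := up_succ t x
      split_ifs at this with hx
      · exact ⟨x + 1, by simp, hx, by omega⟩
      · omega
    · obtain ⟨y, hy, h⟩ := ih h
      exact ⟨y, Icc_subset_Icc_right (by omega) hy, h⟩

theorem exists_closer {k x : ℕ} (hk : 1 ≤ k) (hkx : k ≤ dn t x) :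
    ∃ y ∈ Icc 1 x, t y = (true, false) ∧ dn t y = k := by
  induction x with
  | zero => rw [dn_zero] at hkx; omega
  | succ x ih =>
    rcases Nat.lt_or_ge (dn t x) k with h | h
    · have := dn_succ t x
      split_ifs at this with hx
      · exact ⟨x + 1, by simp, hx, by omega⟩
      · omega
    · obtain ⟨y, hy, h⟩ := ih h
      exact ⟨y, Icc_subset_Icc_right (by omega) hy, h⟩

/-- The label of the block through position `x` in the partition encoded by the word `t`. -/
def label (t : ℕ → Bool × Bool) (x : ℕ) : ℕ := if t x = (true, false) then dn t x else up t x

/-- Two positions are linked by the word `t` if they agree or carry the same label, singletons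
being linked to themselves only. -/
def Linked (t : ℕ → Bool × Bool) (x y : ℕ) : Prop :=
  x = y ∨ t x ≠ (false, false) ∧ t y ≠ (false, false) ∧ label t x = label t y

end Counting

/-! ### From partitions to words: the encoding is an injection into paths. -/

section Parts

variable {n : ℕ} {σ : Finpartition (Icc 1 n)} {x y : ℕ}

theorem mem_Icc_of_mem_part (h : y ∈ σ.part x) : x ∈ Icc 1 n :=
  σ.part_nonempty.1 ⟨y, h⟩

theorem part_eq_part_of_mem (h : y ∈ σ.part x) : σ.part y = σ.part x :=
  σ.part_eq_of_mem (σ.part_mem.2 (mem_Icc_of_mem_part h)) h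

theorem mem_part_comm : y ∈ σ.part x ↔ x ∈ σ.part y := by
  suffices ∀ x y, y ∈ σ.part x → x ∈ σ.part y from ⟨this x y, this y x⟩
  intro x y h
  rw [part_eq_part_of_mem h]
  exact σ.mem_part_self.2 (mem_Icc_of_mem_part h)

theorem finpartition_ext {σ τ : Finpartition (Icc 1 n)} (h : ∀ x, σ.part x = τ.part x) :
    σ = τ := by
  suffices ∀ σ τ : Finpartition (Icc 1 n), (∀ x, σ.part x = τ.part x) → σ.parts ⊆ τ.parts from
    Finpartition.ext (Subset.antisymm (this σ τ h) (this τ σ fun x => (h x).symm))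
  intro σ τ h p hp
  obtain ⟨x, hx⟩ := σ.nonempty_of_mem_parts hp
  rw [← σ.part_eq_of_mem hp hx, h]
  exact τ.part_mem.2 (σ.le hp hx)

/-- The largest element of the block of `x`. -/
def last (σ : Finpartition (Icc 1 n)) (x : ℕ) : ℕ := (σ.part x).sup id

theorem le_last (h : y ∈ σ.part x) : y ≤ last σ x := le_sup (f := id) h

theorem last_mem (h : x ∈ Icc 1 n) : last σ x ∈ σ.part x := by
  obtain ⟨y, hy, hy'⟩ := exists_mem_eq_sup _ (σ.part_nonempty.2 h) id
  rw [last, hy']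
  exact hy

theorem last_eq_last (h : y ∈ σ.part x) : last σ y = last σ x := by
  rw [last, part_eq_part_of_mem h, last]

/-- The word of `σ`: the letter at `x` tells whether the block of `x` has a smaller element, and
whether it has a larger one. -/
def letters (σ : Finpartition (Icc 1 n)) (x : ℕ) : Bool × Bool :=
  (decide (∃ y ∈ σ.part x, y < x), decide (∃ y ∈ σ.part x, x < y))

theorem letters_fst : (letters σ x).1 = true ↔ ∃ y ∈ σ.part x, y < x := by
  simp only [letters, decide_eq_true_eq]

theorem letters_snd : (letters σ x).2 = true ↔ ∃ y ∈ σ.part x, x < y := by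
  simp only [letters, decide_eq_true_eq]

theorem letters_eq_opener :
    letters σ x = (false, true) ↔ (∀ y ∈ σ.part x, x ≤ y) ∧ ∃ y ∈ σ.part x, x < y := by
  simp [letters]

theorem letters_eq_closer :
    letters σ x = (true, false) ↔ (∃ y ∈ σ.part x, y < x) ∧ ∀ y ∈ σ.part x, y ≤ x := by
  simp [letters]

theorem letters_of_notMem (h : x ∉ Icc 1 n) : letters σ x = (false, false) := by
  have := σ.part_eq_empty.2 h
  simp [letters, this]

theorem mem_Icc_of_letters_ne (h : letters σ x ≠ (false, false)) : x ∈ Icc 1 n :=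
  not_imp_comm.1 letters_of_notMem h

theorem letters_eq_isolated (h : x ∈ Icc 1 n) :
    letters σ x = (false, false) ↔ σ.part x = {x} := by
  have hx := σ.mem_part_self.2 h
  constructor
  · intro hl
    simp only [letters, Prod.mk.injEq, decide_eq_false_iff_not, not_exists, not_and, not_lt] at hl
    exact eq_singleton_iff_unique_mem.2 ⟨hx, fun y hy => le_antisymm (hl.2 y hy) (hl.1 y hy)⟩
  · intro hp
    simp [letters, hp]

theorem letters_last (h : letters σ x ≠ (false, false)) : letters σ (last σ x) = (true, false) := by
  have hx := mem_Icc_of_letters_ne h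
  have hl : last σ x ∈ σ.part x := last_mem hx
  rw [letters_eq_closer, part_eq_part_of_mem hl]
  refine ⟨?_, fun y hy => le_last hy⟩
  by_contra! H
  refine h ((letters_eq_isolated hx).2 (eq_singleton_iff_unique_mem.2
    ⟨σ.mem_part_self.2 hx, fun y hy => ?_⟩))
  have h1 := le_antisymm (H y hy) (le_last hy)
  have h2 := le_antisymm (H x (σ.mem_part_self.2 hx)) (le_last (σ.mem_part_self.2 hx))
  omega

theorem last_eq_self (h : letters σ x = (true, false)) : last σ x = x :=
  le_antisymm ((letters_eq_closer.1 h).2 _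
      (last_mem (mem_Icc_of_letters_ne (σ := σ) (by simp [h]))))
    (le_last (σ.mem_part_self.2 (mem_Icc_of_letters_ne (σ := σ) (by simp [h]))))

theorem exists_letters_opener (h : letters σ x = (true, false)) :
    ∃ o ∈ σ.part x, o < x ∧ letters σ o = (false, true) ∧ last σ o = x := by
  have hx : x ∈ Icc 1 n := mem_Icc_of_letters_ne (σ := σ) (by simp [h])
  obtain ⟨o, ho, ho'⟩ := exists_min_image (σ.part x) id (σ.part_nonempty.2 hx)
  obtain ⟨⟨y, hy, hyx⟩, -⟩ := letters_eq_closer.1 h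
  have hox : o < x := (ho' y hy).trans_lt hyx
  refine ⟨o, ho, hox, letters_eq_opener.2 ?_, (last_eq_last ho).trans (last_eq_self h)⟩
  rw [part_eq_part_of_mem ho]
  exact ⟨ho', x, σ.mem_part_self.2 hx, hox⟩

theorem last_injOn : Set.InjOn (last σ) {x | letters σ x = (false, true)} := by
  intro x hx y hy hxy
  rw [Set.mem_ofPred_eq] at hx hy
  have h1 : last σ x ∈ σ.part x := last_mem (mem_Icc_of_letters_ne (σ := σ) (by simp [hx]))
  have h2 : last σ y ∈ σ.part y := last_mem (mem_Icc_of_letters_ne (σ := σ) (by simp [hy]))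
  have h3 : σ.part x = σ.part y := by
    rw [← part_eq_part_of_mem h1, hxy, part_eq_part_of_mem h2]
  rw [letters_eq_opener] at hx hy
  refine le_antisymm (hx.1 y ?_) (hy.1 x ?_)
  · rw [h3]; exact σ.mem_part_self.2 (mem_Icc_of_mem_part h2)
  · rw [← h3]; exact σ.mem_part_self.2 (mem_Icc_of_mem_part h1)

/-- `last` maps the openers up to x bijectively onto the closers up to `last σ x`. An opener before
x whose block ends after `last σ x` would enclose the pair x, `last σ x`; a closer before `last σ x`
whose opener comes after x would be enclosed by it. -/
theorem up_letters (hσ : ¬ HasNesting σ) (h : (letters σ x).2 = true) :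
    up (letters σ) x = dn (letters σ) (last σ x) := by
  obtain ⟨y, hy, hxy⟩ := letters_snd.1 h
  have hx := mem_Icc_of_mem_part hy
  have hxl : x < last σ x := hxy.trans_le (le_last hy)
  have hl : last σ x ∈ σ.part x := last_mem hx
  refine card_bij (fun o _ => last σ o) (fun o ho => ?_) (fun o ho o' ho' => ?_) fun c hc => ?_
  · rw [mem_filter, mem_Icc] at ho ⊢
    have hol : last σ o ∈ σ.part o := last_mem (mem_Icc_of_letters_ne (σ := σ) (by simp [ho.2]))
    refine ⟨⟨(mem_Icc.1 (σ.part_subset _ hol)).1, ?_⟩, letters_last (by simp [ho.2])⟩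
    by_contra! hlt
    have hxo : x ∉ σ.part o := fun hxo => by rw [last_eq_last hxo] at hlt; omega
    have hne : o ≠ x := fun e => hxo (by rw [e]; exact σ.mem_part_self.2 hx)
    exact hσ ⟨o, x, last σ x, last σ o, by omega, hxl, hlt, hol, hl, hxo⟩
  · exact last_injOn (mem_filter.1 ho).2 (mem_filter.1 ho').2
  · rw [mem_filter, mem_Icc] at hc
    obtain ⟨o, ho, hoc, hlo, hlast⟩ := exists_letters_opener hc.2
    refine ⟨o, mem_filter.2 ⟨mem_Icc.2 ⟨(mem_Icc.1 (σ.part_subset _ ho)).1, ?_⟩, hlo⟩, hlast⟩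
    by_contra! hlt
    have hox : o ∉ σ.part x := fun hox =>
      absurd ((letters_eq_opener.1 hlo).1 x (mem_part_comm.1 hox)) (by omega)
    have hne : c ≠ last σ x := fun e => hox (by rwa [e, part_eq_part_of_mem hl] at ho)
    exact hσ ⟨x, o, c, last σ x, hlt, hoc, by omega, hl, mem_part_comm.1 ho, hox⟩

theorem dn_letters_le_up (σ : Finpartition (Icc 1 n)) (x : ℕ) :
    dn (letters σ) x ≤ up (letters σ) x := by
  refine card_le_card_of_surjOn (last σ) fun c hc => ?_
  rw [mem_coe, mem_filter, mem_Icc] at hc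
  obtain ⟨o, ho, hoc, hlo, hlast⟩ := exists_letters_opener hc.2
  exact ⟨o, mem_filter.2 ⟨mem_Icc.2 ⟨(mem_Icc.1 (σ.part_subset _ ho)).1, by omega⟩, hlo⟩, hlast⟩

theorem up_letters_le_dn (σ : Finpartition (Icc 1 n)) :
    up (letters σ) n ≤ dn (letters σ) n := by
  refine card_le_card_of_injOn (last σ) (fun o ho => ?_) fun o ho o' ho' h =>
    last_injOn (mem_filter.1 ho).2 (mem_filter.1 ho').2 h
  rw [mem_coe, mem_filter] at ho ⊢
  exact ⟨σ.part_subset _ (last_mem ho.1), letters_last (by simp [ho.2])⟩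

theorem isPath_letters (hσ : ¬ HasNesting σ) {a : Bool}
    (ha : ∀ x ∈ Icc 1 n, letters σ x = (false, false) → a = true) :
    IsPath a n 0 (letters σ) := by
  refine ⟨fun x => letters_of_notMem, fun x _ => dn_letters_le_up σ x, fun x hx ht => ?_, ha,
    le_antisymm (up_letters_le_dn σ) (dn_letters_le_up σ n)⟩
  have hl : last σ x ∈ σ.part x := last_mem hx
  have hlx : letters σ (last σ x) = (true, false) := letters_last (by simp [ht])
  have hxl : x < last σ x :=
    lt_of_le_of_ne (le_last (σ.mem_part_self.2 hx)) fun e => by rw [← e, ht] at hlx; simp at hlx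
  obtain ⟨f, hf, hfx⟩ := letters_fst.1 (show (letters σ x).1 = true by rw [ht])
  -- By `up_letters` it remains to see that `last σ x` is the only closer after x and up to `last σ
  -- x`.
  rw [up_letters hσ (by rw [ht]), dn, dn, ← card_insert_of_notMem (a := last σ x)
    (by simp only [mem_filter, mem_Icc]; omega)]
  congr 1
  ext c
  simp only [mem_filter, mem_insert, mem_Icc]
  rw [mem_Icc] at hx
  constructor
  · rintro ⟨⟨hc1, hcl⟩, hc⟩
    by_contra! H
    have hxc : x < c := by
      by_contra! hcx
      exact H.2 ⟨hc1, hcx⟩ hc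
    have hcl' : c < last σ x := lt_of_le_of_ne hcl H.1
    have hcx : c ∉ σ.part x := fun h => by
      have := last_eq_last h
      rw [last_eq_self hc] at this
      omega
    obtain ⟨o, ho, hoc, -, -⟩ := exists_letters_opener hc
    have hop : o ∉ σ.part x := fun h => hcx (by
      rw [← part_eq_part_of_mem h]; exact mem_part_comm.1 ho)
    -- Here f is an earlier element of the block of x. If o comes after f, the pair f, `last σ x`
    -- encloses o, c; otherwise o, c encloses f, x.
    rcases lt_or_ge f o with hfo | hof
    · refine hσ ⟨f, o, c, last σ x, hfo, hoc, hcl', ?_, mem_part_comm.1 ho, ?_⟩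
      · rwa [part_eq_part_of_mem hf]
      · rwa [part_eq_part_of_mem hf]
    · have hne : o ≠ f := fun e => hop (e ▸ hf)
      refine hσ ⟨o, f, x, c, by omega, hfx, hxc, mem_part_comm.1 ho, mem_part_comm.1 hf,
        fun h => ?_⟩
      refine hop ?_
      rw [← part_eq_part_of_mem hf]
      exact mem_part_comm.1 h
  · rintro (rfl | ⟨hc, hcl⟩)
    · exact ⟨⟨by omega, le_rfl⟩, hlx⟩
    · exact ⟨⟨hc.1, by omega⟩, hcl⟩

theorem label_letters (hσ : ¬ HasNesting σ) (h : letters σ x ≠ (false, false)) :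
    label (letters σ) x = dn (letters σ) (last σ x) := by
  rw [label]
  split_ifs with hc
  · rw [last_eq_self hc]
  · refine up_letters hσ ?_
    rcases ht : letters σ x with ⟨_ | _, _ | _⟩ <;> simp_all

/-- The label of a non-singleton element is the number of its block's closer among all closers,
which determines the block. Hence the word determines the partition. -/
theorem mem_part_iff_linked (hσ : ¬ HasNesting σ) :
    y ∈ σ.part x ↔ x ∈ Icc 1 n ∧ y ∈ Icc 1 n ∧ Linked (letters σ) x y := by
  constructor
  · intro h
    have hx := mem_Icc_of_mem_part h
    have hy := σ.part_subset _ h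
    refine ⟨hx, hy, ?_⟩
    by_cases hxy : x = y
    · exact Or.inl hxy
    have h1 : letters σ x ≠ (false, false) := fun e => by
      rw [(letters_eq_isolated hx).1 e, mem_singleton] at h
      exact hxy h.symm
    have h2 : letters σ y ≠ (false, false) := fun e => by
      rw [mem_part_comm, (letters_eq_isolated hy).1 e, mem_singleton] at h
      exact hxy h
    refine Or.inr ⟨h1, h2, ?_⟩
    rw [label_letters hσ h1, label_letters hσ h2, last_eq_last h]
  · rintro ⟨hx, hy, rfl | ⟨h1, h2, h⟩⟩
    · exact σ.mem_part_self.2 hx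
    · rw [label_letters hσ h1, label_letters hσ h2] at h
      have hl : last σ x = last σ y := by
        rcases lt_trichotomy (last σ x) (last σ y) with hlt | he | hlt
        · exact absurd h (dn_lt_dn hlt (letters_last h2)).ne
        · exact he
        · exact absurd h (dn_lt_dn hlt (letters_last h1)).ne'
      rw [← part_eq_part_of_mem (last_mem hx), hl, part_eq_part_of_mem (last_mem hy)]
      exact σ.mem_part_self.2 hy

theorem letters_injOn : Set.InjOn letters {σ : Finpartition (Icc 1 n) | ¬ HasNesting σ} := by
  intro σ hσ τ hτ h
  refine finpartition_ext fun x => ?_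
  ext y
  rw [mem_part_iff_linked hσ, mem_part_iff_linked hτ, h]

end Parts

/-! ### From words to partitions: every path is the word of an avoider. -/

section Surjectivity

/-- `Linked t` as an equivalence relation. -/
def linkedSetoid (t : ℕ → Bool × Bool) : Setoid ℕ where
  r := Linked t
  iseqv :=
    { refl := fun _ => Or.inl rfl
      symm := by
        rintro x y (rfl | ⟨h1, h2, h⟩)
        exacts [Or.inl rfl, Or.inr ⟨h2, h1, h.symm⟩]
      trans := by
        rintro x y z (rfl | ⟨h1, h2, h⟩) (rfl | ⟨h3, h4, h'⟩)
        exacts [Or.inl rfl, Or.inr ⟨h3, h4, h'⟩, Or.inr ⟨h1, h2, h⟩, Or.inr ⟨h1, h4, h.trans h'⟩] }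

open Classical in
/-- The partition of `[n]` encoded by the word `t`. -/
noncomputable def ofWord (n : ℕ) (t : ℕ → Bool × Bool) : Finpartition (Icc 1 n) :=
  Finpartition.ofSetSetoid (linkedSetoid t) (Icc 1 n)

variable {a : Bool} {n : ℕ} {t : ℕ → Bool × Bool} {x y : ℕ}

theorem mem_part_ofWord :
    y ∈ (ofWord n t).part x ↔ x ∈ Icc 1 n ∧ y ∈ Icc 1 n ∧ Linked t x y := by
  classical
  exact Finpartition.mem_part_ofSetSetoid_iff_rel _

theorem IsPath.exists_earlier (H : IsPath a n 0 t) (hx : x ∈ Icc 1 n) :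
    (∃ y ∈ (ofWord n t).part x, y < x) ↔ (t x).1 = true := by
  have hle := H.dn_le_up x (mem_Icc.1 hx).2
  have htr := H.transient x hx
  simp only [mem_part_ofWord]
  constructor
  · rintro ⟨y, ⟨-, hy, hxy | ⟨h1, h2, h⟩⟩, hlt⟩
    · omega
    · by_contra h3
      have ht : t x = (false, true) := by
        rcases ht : t x with ⟨_ | _, _ | _⟩ <;> simp_all
      have h4 := up_lt_up hlt ht
      have h5 := H.dn_le_up y (mem_Icc.1 hy).2
      simp only [label, ht] at h
      split_ifs at h <;> simp_all <;> omega
  · intro h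
    -- These bounds provide an opener, at or before x, whose number is the label of x.
    have hk : 1 ≤ label t x ∧ label t x ≤ up t x := by
      rw [label]
      split_ifs with hc
      · exact ⟨Nat.zero_lt_of_lt (dn_lt_dn (mem_Icc.1 hx).1 hc), hle⟩
      · have : t x = (true, true) := by
          rcases ht : t x with ⟨_ | _, _ | _⟩ <;> simp_all
        have := htr this
        omega
    obtain ⟨o, ho, hto, hup⟩ := exists_opener hk.1 hk.2
    rw [mem_Icc] at ho hx
    have hne : o ≠ x := by
      rintro rfl
      simp [hto] at h
    refine ⟨o, ⟨mem_Icc.2 hx, mem_Icc.2 ⟨ho.1, by omega⟩, Or.inr ⟨?_, by simp [hto], ?_⟩⟩,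
      by omega⟩
    · intro e
      simp [e] at h
    · rw [label.eq_def t o, if_neg (by simp [hto]), hup]

theorem IsPath.exists_later (H : IsPath a n 0 t) (hx : x ∈ Icc 1 n) :
    (∃ y ∈ (ofWord n t).part x, x < y) ↔ (t x).2 = true := by
  have hle := H.dn_le_up x (mem_Icc.1 hx).2
  have htr := H.transient x hx
  simp only [mem_part_ofWord]
  constructor
  · rintro ⟨y, ⟨-, hy, hxy | ⟨h1, h2, h⟩⟩, hlt⟩
    · omega
    · by_contra h3
      have ht : t x = (true, false) := by
        rcases ht : t x with ⟨_ | _, _ | _⟩ <;> simp_all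
      rw [label, label, if_pos ht] at h
      split_ifs at h with hy'
      · exact absurd h (dn_lt_dn hlt hy').ne
      · rcases hty : t y with ⟨_ | _, _ | _⟩
        · exact h2 hty
        · have := up_lt_up hlt hty
          omega
        · exact hy' hty
        · have := H.transient y hy hty
          have := dn_mono t hlt.le
          omega
  · intro h
    have hc : t x ≠ (true, false) := by
      intro e
      simp [e] at h
    have hlab : label t x = up t x := if_neg hc
    have hn := H.height
    have hun := up_mono t (mem_Icc.1 hx).2
    have hpos : 1 ≤ up t x := by
      rcases ht : t x with ⟨_ | _, _ | _⟩
      · simp [ht] at h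
      · exact Nat.zero_lt_of_lt (up_lt_up (mem_Icc.1 hx).1 ht)
      · exact absurd ht hc
      · have := htr ht
        omega
    -- The path ends at height 0, so there are at least `up t x` closers and the one with that
    -- number exists.
    obtain ⟨c, hcn, htc, hdc⟩ := exists_closer (t := t) (x := n) hpos (by omega)
    refine ⟨c, ⟨hx, hcn, Or.inr ⟨?_, by simp [htc], ?_⟩⟩, ?_⟩
    · intro e
      simp [e] at h
    · rw [hlab, label, if_pos htc, hdc]
    · by_contra! hcx
      have hne : c ≠ x := by
        rintro rfl
        exact hc htc
      rcases ht : t x with ⟨_ | _, _ | _⟩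
      · simp [ht] at h
      · have := up_lt_up (lt_of_le_of_ne hcx hne) ht
        have := H.dn_le_up c (mem_Icc.1 hcn).2
        omega
      · exact hc ht
      · have := htr ht
        have := dn_mono t hcx
        omega

theorem IsPath.letters_ofWord (H : IsPath a n 0 t) : letters (ofWord n t) = t := by
  funext x
  by_cases hx : x ∈ Icc 1 n
  · refine Prod.ext ?_ ?_
    · rw [Bool.eq_iff_iff, letters_fst, H.exists_earlier hx]
    · rw [Bool.eq_iff_iff, letters_snd, H.exists_later hx]
  · rw [letters_of_notMem hx, H.supp x hx]

/-- Labels weakly increase along elements that have a later block mate, and along those that have an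
earlier one. A nesting p < q < r < s would give label p ≤ label q = label r ≤ label s = label p,
putting p and q in one block. -/
theorem IsPath.not_hasNesting (H : IsPath a n 0 t) : ¬ HasNesting (ofWord n t) := by
  rintro ⟨p, q, r, s, hpq, hqr, hrs, hps, hqr', hqp⟩
  have hp := mem_Icc_of_mem_part hps
  have hq := mem_Icc_of_mem_part hqr'
  have hs := Finpartition.part_subset _ _ hps
  have hr := Finpartition.part_subset _ _ hqr'
  have tp := (H.exists_later hp).1 ⟨s, hps, by omega⟩
  have tq := (H.exists_later hq).1 ⟨r, hqr', by omega⟩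
  have ts := (H.exists_earlier hs).1 ⟨p, mem_part_comm.1 hps, by omega⟩
  have tr := (H.exists_earlier hr).1 ⟨q, mem_part_comm.1 hqr', by omega⟩
  obtain ⟨-, -, hps | ⟨p0, -, lps⟩⟩ := mem_part_ofWord.1 hps
  · omega
  obtain ⟨-, -, hqr' | ⟨q0, -, lqr⟩⟩ := mem_part_ofWord.1 hqr'
  · omega
  have h1 : label t p ≤ label t q := by
    rw [label, label, if_neg fun e => by simp [e] at tp, if_neg fun e => by simp [e] at tq]
    exact up_mono t hpq.le
  have h2 : label t r ≤ label t s := by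
    -- A closer has label `dn`, a transient `dn + 1`; the strict bound `hlt` compensates when r is
    -- transient and s a closer.
    have hm := dn_mono t hrs.le
    have hlt := fun h => dn_lt_dn (t := t) hrs h
    have htr := H.transient r hr
    have hts := H.transient s hs
    rw [label, label]
    rcases er : t r with ⟨_ | _, _ | _⟩ <;> rcases es : t s with ⟨_ | _, _ | _⟩ <;>
      simp [er, es] at tr ts htr hts hlt ⊢ <;> omega
  exact hqp (mem_part_ofWord.2 ⟨hp, hq, Or.inr ⟨p0, q0, by omega⟩⟩)

end Surjectivity

/-! ### Equality of the counts of avoiders and paths. -/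

section Cardinality

variable {n : ℕ}

theorem card_avoiders (n : ℕ) : #(avoiders n pattern14_23) = #(paths true n 0) := by
  refine card_bij (fun σ _ => letters σ) (fun σ hσ => ?_) (fun σ hσ τ hτ h => ?_) fun t ht => ?_
  · exact mem_paths.2 (isPath_letters (mem_avoiders.1 hσ) fun _ _ _ => rfl)
  · exact letters_injOn (mem_avoiders.1 hσ) (mem_avoiders.1 hτ) h
  · have H := mem_paths.1 ht
    exact ⟨ofWord n t, mem_avoiders.2 H.not_hasNesting, H.letters_ofWord⟩

theorem card_ne_one_iff {σ : Finpartition (Icc 1 n)} :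
    (∀ B ∈ σ.parts, #B ≠ 1) ↔ ∀ x ∈ Icc 1 n, letters σ x ≠ (false, false) := by
  constructor
  · intro h x hx e
    refine h _ (σ.part_mem.2 hx) ?_
    rw [(letters_eq_isolated hx).1 e, card_singleton]
  · intro h B hB e
    obtain ⟨x, rfl⟩ := card_eq_one.1 e
    have hx : x ∈ Icc 1 n := σ.le hB (mem_singleton_self x)
    exact h x hx ((letters_eq_isolated hx).2 (σ.part_eq_of_mem hB (mem_singleton_self x)))

theorem card_singletonFreeAvoiders (n : ℕ) :
    #(singletonFreeAvoiders n pattern14_23) = #(paths false n 0) := by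
  refine card_bij (fun σ _ => letters σ) (fun σ hσ => ?_) (fun σ hσ τ hτ h => ?_) fun t ht => ?_
  · rw [singletonFreeAvoiders, mem_filter, card_ne_one_iff] at hσ
    exact mem_paths.2 (isPath_letters (mem_avoiders.1 hσ.1) fun x hx h => absurd h (hσ.2 x hx))
  · rw [singletonFreeAvoiders, mem_filter] at hσ hτ
    exact letters_injOn (mem_avoiders.1 hσ.1) (mem_avoiders.1 hτ.1) h
  · have H := mem_paths.1 ht
    refine ⟨ofWord n t, ?_, H.letters_ofWord⟩
    rw [singletonFreeAvoiders, mem_filter, card_ne_one_iff, mem_avoiders, H.letters_ofWord]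
    exact ⟨H.not_hasNesting, fun x hx h => by simpa using H.isolated x hx h⟩

end Cardinality

end KlazarPattern

theorem mainTheorem10 :
    PowerSeries.mk (fun n => ((KlazarPattern.avoiders n KlazarPattern.pattern14_23).card : ℚ)) =
        KlazarPattern.G.subst KlazarPattern.zDivOneSub * (1 - PowerSeries.X)⁻¹
          + (1 - PowerSeries.X)⁻¹ ∧
      KlazarPattern.G =
        PowerSeries.mk (fun n => if 2 ≤ n then
          ((KlazarPattern.singletonFreeAvoiders n KlazarPattern.pattern14_23).card : ℚ) else 0) := by
  constructor
  · simp only [KlazarPattern.card_avoiders]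
    exact KlazarPattern.isPathSystem_closed_form (Or.inr rfl)
      (by simpa using KlazarPattern.isPathSystem_paths true)
  · have h := KlazarPattern.isPathSystem_closed_form (Or.inl rfl)
      (by simpa using KlazarPattern.isPathSystem_paths false)
    rw [if_pos rfl] at h
    rw [← add_right_inj (1 : PowerSeries ℚ), ← h]
    ext n
    -- In degrees 0 and 1 the path counts are 1 and 0, so the added 1 accounts for the empty
    -- partition and G starts in degree 2.
    rcases n with _ | _ | n
    · simp [KlazarPattern.paths]
    · simp [KlazarPattern.paths, KlazarPattern.setLetter, PowerSeries.coeff_one]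
    · simp [KlazarPattern.card_singletonFreeAvoiders, PowerSeries.coeff_one]
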